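/- Let $G^+=\langle a,b,c \mid cbb=bba,\ ab=bc,\ ac=ca\rangle_{mo}$ be the monoid given by this presentation, with identity $\varepsilon$. For $U,V\in G^+$ write $U\,|_l\,V$ if $V=UX$ for some $X\in G^+$ and $U\,|_r\,V$ if $V=XU$ for some $X\in G^+$. For $w\in G^+$ let $$\mathrm{Trans}(w)=\{A\in G^+ \mid A\neq\varepsilon,\ AQ=wA \text{ for some } Q\in G^+\},$$ and let $\mathrm{Trans^{min}}(w)$ be the set of those $A\in\mathrm{Trans}(w)$ such that every $B\in \mathrm{Trans}(w)$ with $B\,|_l\,A$ equals $A$. Let $W(j)$ be the set of elements of $G^+$ represented by words containing the letter $b$ exactly $j$ times, and put $\Delta_i=(bc^i)^3$ for $i\ge 0$. An element $\Delta\in G^+$ is quasi-central if there is a permutation $\sigma$ of $\{a,b,c\}$ with $s\Delta=\Delta\sigma(s)$ for all letters $s$; a quasi-central element $\Delta\ne\varepsilon$ is indecomposable if it is not a product of two quasi-central elements different from $\varepsilon$. An element $\Delta$ is fundamental if there is a permutation $\sigma$ of $\{a,b,c\}$ such that for every letter $s$ there is $\Delta_s\in G^+$ with $\Delta=s\Delta_s=\Delta_s\sigma(s)$;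 it is a minimal fundamental element if every fundamental element dividing it from the left or from the right equals it. A right least common multiple of $U$ and $V$ is an element $M$ with $U\,|_l\,M$, $V\,|_l\,M$ such that $M\,|_l\,N$ for every $N$ with $U\,|_l\,N$ and $V\,|_l\,N$; left least common multiples are defined in the same way with $|_r$. The right (resp. left) LCM condition says that any two elements of $G^+$ have a right (resp. left) least common multiple. Then the following hold. The monoid $G^+$ satisfies neither the left nor the right LCM condition. The element $\Delta_0=bbb$ is an indecomposable quasi-central element that is not fundamental, and $\Delta_i$ is a minimal fundamental element for every $i\ge1$. Moreover $$W(0)=\{a^pc^q\},\quad W(1)=\{a^pc^qba^r\},\quad W(2)=\{a^pc^qbbc^r\},\quad W(3)=\{a^pc^qba^rbb\}\qquad(p,q,r\ge0).$$ **Case 1.** Let $w=a^pc^q$. - If $p=q=0$ (that is, $w=\varepsilon$): $\mathrm{Trans^{min}}(w)=\{a,b,c\}$. - If $p=0$, $q\ge1$: $\mathrm{Trans^{min}}(w)=\{a,c,bb\}$. - If $q=0$, $p\ge1$: $\mathrm{Trans^{min}}(w)=\{a,b,c\}$. - If $p,q\ge1$: $\mathrm{Trans^{min}}(w)=\{a,c\}\cup\{bbc^ib\mid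 i\ge0\}$. **Case 2.** Let $w=a^pc^qba^r$ with $r\ge0$. - If $p=0$, $q\ge1$: $\mathrm{Trans^{min}}(w)=\{b,c\}$. - If $q=0$, $p\ge1$: $\mathrm{Trans^{min}}(w)=\{a\}\cup\{c^iba^i\mid 0\le i\le r\}$. - If $p,q\ge1$: $\mathrm{Trans^{min}}(w)=\{a,b,c\}$. - If $p=q=0$: $\mathrm{Trans^{min}}(w)=\{c^iba^i\mid 0\le i\le r\}\cup\{a^{i-r}c^iba^i\mid i\ge r+1\}$. **Case 3.** Let $w=a^pc^qbbc^r$ with $r\ge0$. - If $p=0$, $q\ge1$: $\mathrm{Trans^{min}}(w)=\{b,c\}$. - If $q=0$, $p\ge1$: $\mathrm{Trans^{min}}(w)=\{a,b\}$. - If $p,q\ge1$: $\mathrm{Trans^{min}}(w)=\{a,b,c\}$. - If $p=q=0$: $\mathrm{Trans^{min}}(w)=\{a^ic^iba^i\mid i\ge0\}$. **Case 4.** If $w\in W(3)$, then $\mathrm{Trans^{min}}(w)=\{a,b,c\}$. For every $w\in G^+$ and every $u\in\mathrm{Trans^{min}}(w)$ there is $i\ge0$ with $u\,|_l\,\Delta_i$.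 Finally, the conjugacy problem in $G^+$ is solvable: there is an algorithm that decides, for any two words $U,V$ in the letters $a,b,c$, whether there is $A\in G^+$ with $AU=VA$ in $G^+$. -/

import Mathlib

namespace Bii

/-- The defining relations `cbb = bba`, `ab = bc`, `ac = ca` on the letters `a = 0`, `b = 1`,
`c = 2`. -/
inductive Rel : FreeMonoid (Fin 3) → FreeMonoid (Fin 3) → Prop
  | cbb : Rel (FreeMonoid.ofList [2, 1, 1]) (FreeMonoid.ofList [1, 1, 0])
  | ab : Rel (FreeMonoid.ofList [0, 1]) (FreeMonoid.ofList [1, 2])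
  | ac : Rel (FreeMonoid.ofList [0, 2]) (FreeMonoid.ofList [2, 0])

/-- The monoid `⟨a, b, c ∣ cbb = bba, ab = bc, ac = ca⟩`. -/
abbrev G : Type := PresentedMonoid Rel

/-- The element of `G` represented by a positive word. -/
def ofWord (x : List (Fin 3)) : G := PresentedMonoid.mk Rel (FreeMonoid.ofList x)

/-- The image of a letter in `G`. -/
def gen (s : Fin 3) : G := PresentedMonoid.of Rel s

/-- The generator `a`. -/
def a : G := gen 0

/-- The generator `b`. -/
def b : G := gen 1

/-- The generator `c`. -/
def c : G := gen 2

/-- `W j` is the set of elements that are represented by a word in which the letter `b` occurs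
exactly `j` times. -/
def W (j : ℕ) : Set G := {w | ∃ x : List (Fin 3), ofWord x = w ∧ x.count 1 = j}

/-- `u` divides `v` from the left. -/
def LeftDvd (u v : G) : Prop := ∃ d : G, v = u * d

/-- `u` divides `v` from the right. -/
def RightDvd (u v : G) : Prop := ∃ d : G, v = d * u

/-- The set of right transit elements of `w`. -/
def Trans (w : G) : Set G := {A | A ≠ 1 ∧ ∃ Q : G, A * Q = w * A}

/-- The set of right minimal transit elements of `w`. -/
def TransMin (w : G) : Set G :=
  {A | A ∈ Trans w ∧ ∀ B ∈ Trans w, LeftDvd B A → B = A}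

/-- The elements `Δ i = (b c ^ i) ^ 3`. -/
def Δ (i : ℕ) : G := (b * c ^ i) ^ 3

/-- `D` is quasi-central: some permutation `σ` of the letters satisfies `s D = D σ(s)` for all
letters `s`. -/
def IsQuasiCentral (D : G) : Prop :=
  ∃ σ : Equiv.Perm (Fin 3), ∀ s, gen s * D = D * gen (σ s)

/-- `D` is an indecomposable quasi-central element. -/
def IsIndecomposableQuasiCentral (D : G) : Prop :=
  IsQuasiCentral D ∧ D ≠ 1 ∧
    ∀ x y : G, IsQuasiCentral x → IsQuasiCentral y → D = x * y → x = 1 ∨ y = 1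

/-- `D` is a fundamental element: for some permutation `σ` of the letters there is, for every
letter `s`, an element `E` with `D = s E = E σ(s)`. -/
def IsFundamental (D : G) : Prop :=
  ∃ σ : Equiv.Perm (Fin 3), ∀ s, ∃ E : G, D = gen s * E ∧ D = E * gen (σ s)

/-- `D` is a minimal fundamental element. -/
def IsMinimalFundamental (D : G) : Prop :=
  IsFundamental D ∧
    ∀ D' : G, IsFundamental D' → (LeftDvd D' D ∨ RightDvd D' D) → D' = D

/-- `m` is a right least common multiple of `u` and `v`. -/
def IsRightLCM (u v m : G) : Prop :=
  LeftDvd u m ∧ LeftDvd v m ∧ ∀ n : G, LeftDvd u n → LeftDvd v n → LeftDvd m n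

/-- `m` is a left least common multiple of `u` and `v`. -/
def IsLeftLCM (u v m : G) : Prop :=
  RightDvd u m ∧ RightDvd v m ∧ ∀ n : G, RightDvd u n → RightDvd v n → RightDvd m n

/-- The right LCM condition: any two elements have a right least common multiple. -/
def RightLCMCondition : Prop := ∀ u v : G, ∃ m : G, IsRightLCM u v m

/-- The left LCM condition: any two elements have a left least common multiple. -/
def LeftLCMCondition : Prop := ∀ u v : G, ∃ m : G, IsLeftLCM u v m

/-- The conjugacy problem is solvable: some algorithm decides, for words `U` and `V`, whether
there is `A` in `G` with `A U = V A` in `G`. -/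
def ConjugacyProblemSolvable : Prop :=
  ComputablePred fun x : List (Fin 3) × List (Fin 3) =>
    ∃ A : G, A * ofWord x.1 = ofWord x.2 * A

end Bii

/-! Conjugation by `b` permutes the three commuting elements `a`, `c`, `d` cyclically, so
multiplication in `G` is that of the semidirect product of ℤ³ by ℤ, with the generator of ℤ rotating
coordinates: `(v, n)(v', n') = (v + ρⁿ v', n + n')`. The elements of `G` are exactly the quadruples
of natural numbers `(x, y, z, n)` with `z = 0` whenever `n = 0`. Coordinates come from an action of
`G` on ℕ⁴. Every element has a normal form (`exists_eq_normalForm`), and the action recovers its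
exponents (`hasCoords_normalForm`), so the coordinates are faithful.

The multiplication law `coords_mul` then turns each claim into linear arithmetic with a case split
on `n` mod 3, within reach of `omega`. The constraint `n = 0 → z = 0` causes all the irregularity:
if two elements have the same number of letters `b`, left divisibility forces one of their other
coordinates to agree (`leftDvd_iff`). This defeats the LCM conditions and produces the infinite
families of minimal transit elements, whose members differ in that rigid coordinate.

For conjugacy, `A U = V A` reads `V - ρᵐ U = (1 - ρᵏ) A`, where `m` and `k` are the numbers of
letters `b` in `A` and `V`. If 3 divides `k`, the right side vanishes, and `V` must be a rotation of
`U`. Otherwise the image of `1 - ρᵏ` consists of the vectors of sum zero, and only the coordinate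
sums are compared. -/

namespace Bii

/-! ### Coordinates

In the group with the same presentation the elements `a`, `c` and `d = b a b⁻¹` commute and are
permuted cyclically by `b`. Accordingly every element of `G` is determined by its exponents
`X`, `Y`, `Z` of `a`, `c`, `d` and by the number `B` of letters `b`. -/

/-- The action of a letter on coordinates: the letters `a` and `c` increase the first and the
second coordinate, and `b` rotates the first three coordinates and increases the last one. -/
def step (s : Fin 3) (v : ℕ × ℕ × ℕ × ℕ) : ℕ × ℕ × ℕ × ℕ :=
  if s = 0 then (v.1 + 1, v.2.1, v.2.2.1, v.2.2.2)
  else if s = 1 then (v.2.1, v.2.2.1, v.1, v.2.2.2 + 1)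
  else (v.1, v.2.1 + 1, v.2.2.1, v.2.2.2)

/-- The action of a letter on coordinates, as an element of the monoid of self-maps. -/
def stepEnd : Fin 3 → Function.End (ℕ × ℕ × ℕ × ℕ) := step

lemma lift_stepEnd_eq_of_rel (x y : FreeMonoid (Fin 3)) (h : Rel x y) :
    FreeMonoid.lift stepEnd x = FreeMonoid.lift stepEnd y := by
  cases h <;> rfl

/-- The left action of `G` on coordinates. -/
def act : G →* Function.End (ℕ × ℕ × ℕ × ℕ) :=
  PresentedMonoid.lift stepEnd lift_stepEnd_eq_of_rel

lemma act_gen (s : Fin 3) (v : ℕ × ℕ × ℕ × ℕ) : act (gen s) v = step s v := rfl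

lemma act_a (v : ℕ × ℕ × ℕ × ℕ) : act a v = (v.1 + 1, v.2.1, v.2.2.1, v.2.2.2) := rfl

lemma act_b (v : ℕ × ℕ × ℕ × ℕ) : act b v = (v.2.1, v.2.2.1, v.1, v.2.2.2 + 1) := rfl

lemma act_c (v : ℕ × ℕ × ℕ × ℕ) : act c v = (v.1, v.2.1 + 1, v.2.2.1, v.2.2.2) := rfl

lemma act_mul (g h : G) (v : ℕ × ℕ × ℕ × ℕ) : act (g * h) v = act g (act h v) := by
  rw [map_mul]; rfl

lemma act_one (v : ℕ × ℕ × ℕ × ℕ) : act 1 v = v := by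
  rw [map_one]; rfl

lemma act_a_pow (n : ℕ) (v : ℕ × ℕ × ℕ × ℕ) :
    act (a ^ n) v = (v.1 + n, v.2.1, v.2.2.1, v.2.2.2) := by
  induction n with
  | zero => simp [act_one]
  | succ n ih => rw [pow_succ', act_mul, ih, act_a]; simp [add_assoc]

lemma act_c_pow (n : ℕ) (v : ℕ × ℕ × ℕ × ℕ) :
    act (c ^ n) v = (v.1, v.2.1 + n, v.2.2.1, v.2.2.2) := by
  induction n with
  | zero => simp [act_one]
  | succ n ih => rw [pow_succ', act_mul, ih, act_c]; simp [add_assoc]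

lemma act_b_pow_zero (n : ℕ) : act (b ^ n) (0, 0, 0, 0) = (0, 0, 0, n) := by
  induction n with
  | zero => simp [act_one]
  | succ n ih => rw [pow_succ', act_mul, ih, act_b]

/-- The exponent of `a` in the normal form. -/
def X (g : G) : ℕ := (act g (0, 0, 0, 0)).1

/-- The exponent of `c` in the normal form. -/
def Y (g : G) : ℕ := (act g (0, 0, 0, 0)).2.1

/-- The exponent of the conjugate `b a b⁻¹` in the normal form. -/
def Z (g : G) : ℕ := (act g (0, 0, 0, 0)).2.2.1

/-- The number of letters `b`. -/
def B (g : G) : ℕ := (act g (0, 0, 0, 0)).2.2.2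

/-- The four coordinates of an element are the given numbers. -/
def HasCoords (g : G) (x y z n : ℕ) : Prop := X g = x ∧ Y g = y ∧ Z g = z ∧ B g = n

lemma hasCoords_of_act {g : G} {x y z n : ℕ} (h : act g (0, 0, 0, 0) = (x, y, z, n)) :
    HasCoords g x y z n := by
  simp [HasCoords, X, Y, Z, B, h]

/-! ### Words, induction on letters, and commutation rules -/

lemma ofWord_cons (s : Fin 3) (x : List (Fin 3)) : ofWord (s :: x) = gen s * ofWord x :=
  map_mul (PresentedMonoid.mk Rel) (FreeMonoid.of s) (FreeMonoid.ofList x)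

lemma ofWord_nil : ofWord [] = 1 := rfl

lemma exists_ofWord (g : G) : ∃ x, ofWord x = g := by
  obtain ⟨x, rfl⟩ := PresentedMonoid.surjective_mk g
  exact ⟨x.toList, rfl⟩

@[elab_as_elim]
lemma gen_induction {p : G → Prop} (g : G) (one : p 1) (ha : ∀ g, p g → p (a * g))
    (hb : ∀ g, p g → p (b * g)) (hc : ∀ g, p g → p (c * g)) : p g := by
  obtain ⟨x, rfl⟩ := exists_ofWord g
  induction x with
  | nil => exact one
  | cons s x ih =>
    rw [ofWord_cons]
    fin_cases s
    · exact ha _ ih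
    · exact hb _ ih
    · exact hc _ ih

lemma a_mul_b : a * b = b * c := PresentedMonoid.mk_eq_mk_of_rel Rel.ab

lemma a_mul_c : a * c = c * a := PresentedMonoid.mk_eq_mk_of_rel Rel.ac

lemma c_mul_b_mul_b : c * b * b = b * b * a := PresentedMonoid.mk_eq_mk_of_rel Rel.cbb

lemma a_pow_mul_c_pow (p q : ℕ) : a ^ p * c ^ q = c ^ q * a ^ p :=
  Commute.pow_pow a_mul_c p q

lemma a_pow_mul_b (p : ℕ) : a ^ p * b = b * c ^ p :=
  (SemiconjBy.pow_right (a := b) (x := c) (y := a) a_mul_b.symm p).symm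

lemma c_pow_mul_b_mul_b (p : ℕ) : c ^ p * (b * b) = b * b * a ^ p := by
  have h : SemiconjBy (b * b) a c := by
    rw [SemiconjBy, ← c_mul_b_mul_b, mul_assoc]
  exact (h.pow_right p).symm

/-- The normal form with given coordinates, provided that `z = 0` if `n = 0`. -/
def normalForm (x y z n : ℕ) : G := a ^ x * c ^ y * if n = 0 then 1 else b * a ^ z * b ^ (n - 1)

lemma hasCoords_normalForm {x y z n : ℕ} (h : n = 0 → z = 0) :
    HasCoords (normalForm x y z n) x y z n := by
  apply hasCoords_of_act
  rcases n with _ | n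
  · simp [normalForm, act_mul, act_a_pow, act_c_pow, h rfl]
  · simp [normalForm, act_mul, act_a_pow, act_c_pow, act_b_pow_zero, act_b]

lemma exists_hasCoords (x y z n : ℕ) (h : n = 0 → z = 0) : ∃ g, HasCoords g x y z n :=
  ⟨_, hasCoords_normalForm h⟩

lemma a_mul_normalForm (x y z n : ℕ) : a * normalForm x y z n = normalForm (x + 1) y z n := by
  simp only [normalForm, pow_succ', mul_assoc]

lemma c_mul_normalForm (x y z n : ℕ) : c * normalForm x y z n = normalForm x (y + 1) z n := by
  have h : c * a ^ x = a ^ x * c := by simpa using (a_pow_mul_c_pow x 1).symm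
  simp only [normalForm, pow_succ', ← mul_assoc, h]

/-- Conjugation by `b` sends `a` to `d`, `d` to `c` and `c` to `a`, which rotates the exponents. The
computation stays inside the monoid and needs no inverses. -/
lemma b_mul_normalForm {x y z n : ℕ} (h : n = 0 → z = 0) :
    b * normalForm x y z n = normalForm y z x (n + 1) := by
  rcases n with _ | n
  · simp only [normalForm, h rfl, if_true, mul_one, pow_zero, a_pow_mul_c_pow, ← mul_assoc,
      ← a_pow_mul_b]
    simp [mul_assoc]
  · simp only [normalForm, Nat.add_eq_zero_iff, one_ne_zero, and_false, if_false,
      Nat.add_sub_cancel]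
    calc b * (a ^ x * c ^ y * (b * a ^ z * b ^ n))
        = b * c ^ y * (a ^ x * b) * a ^ z * b ^ n := by
          rw [a_pow_mul_c_pow]; simp only [mul_assoc]
      _ = a ^ y * (b * b) * (a ^ z * c ^ x) * b ^ n := by
          rw [← a_pow_mul_b, a_pow_mul_b x, a_pow_mul_c_pow]; simp only [mul_assoc]
      _ = a ^ y * c ^ z * b * (b * c ^ x) * b ^ n := by
          have h2 := c_pow_mul_b_mul_b z
          calc _ = a ^ y * (b * b * a ^ z) * c ^ x * b ^ n := by simp only [mul_assoc]
            _ = _ := by rw [← h2]; simp only [mul_assoc]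
      _ = a ^ y * c ^ z * (b * a ^ x * b ^ (n + 1)) := by
          rw [← a_pow_mul_b, pow_succ']; simp only [mul_assoc]

/-- The normal forms contain `1` and are closed under left multiplication by each letter. -/
lemma exists_eq_normalForm (g : G) :
    ∃ x y z n : ℕ, (n = 0 → z = 0) ∧ g = normalForm x y z n := by
  induction g using gen_induction with
  | one => exact ⟨0, 0, 0, 0, fun _ => rfl, by simp [normalForm]⟩
  | ha g ih =>
    obtain ⟨x, y, z, n, h, rfl⟩ := ih
    exact ⟨_, _, _, _, h, a_mul_normalForm x y z n⟩
  | hb g ih =>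
    obtain ⟨x, y, z, n, h, rfl⟩ := ih
    exact ⟨_, _, _, _, by simp, b_mul_normalForm h⟩
  | hc g ih =>
    obtain ⟨x, y, z, n, h, rfl⟩ := ih
    exact ⟨_, _, _, _, h, c_mul_normalForm x y z n⟩

lemma eq_normalForm_of_hasCoords {g : G} {x y z n : ℕ} (hg : HasCoords g x y z n) :
    g = normalForm x y z n := by
  obtain ⟨x', y', z', n', h, rfl⟩ := exists_eq_normalForm g
  obtain ⟨hx, hy, hz, hn⟩ := hasCoords_normalForm h (x := x') (y := y')
  rw [← hg.1, ← hg.2.1, ← hg.2.2.1, ← hg.2.2.2, hx, hy, hz, hn]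

lemma Z_eq_zero_of_B_eq_zero (g : G) (hB : B g = 0) : Z g = 0 := by
  obtain ⟨x, y, z, n, h, rfl⟩ := exists_eq_normalForm g
  obtain ⟨-, -, hz, hn⟩ := hasCoords_normalForm h (x := x) (y := y)
  rw [hz]; exact h (hn ▸ hB)

lemma HasCoords.eq {g h : G} {x y z n : ℕ} (hg : HasCoords g x y z n) (hh : HasCoords h x y z n) :
    g = h :=
  (eq_normalForm_of_hasCoords hg).trans (eq_normalForm_of_hasCoords hh).symm

lemma eq_iff_coords (g h : G) : g = h ↔ X g = X h ∧ Y g = Y h ∧ Z g = Z h ∧ B g = B h :=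
  ⟨by rintro rfl; simp, fun hg => HasCoords.eq hg ⟨rfl, rfl, rfl, rfl⟩⟩

lemma HasCoords.eq_iff {h : G} {x y z n : ℕ} (hh : HasCoords h x y z n) (g : G) :
    g = h ↔ X g = x ∧ Y g = y ∧ Z g = z ∧ B g = n := by
  obtain ⟨rfl, rfl, rfl, rfl⟩ := hh
  exact eq_iff_coords g h

lemma act_apply (g : G) (v : ℕ × ℕ × ℕ × ℕ) :
    (act g v).2.2.2 = B g + v.2.2.2 ∧
    ((B g % 3 = 0 ∧ (act g v).1 = X g + v.1 ∧ (act g v).2.1 = Y g + v.2.1 ∧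
        (act g v).2.2.1 = Z g + v.2.2.1) ∨
      (B g % 3 = 1 ∧ (act g v).1 = X g + v.2.1 ∧ (act g v).2.1 = Y g + v.2.2.1 ∧
        (act g v).2.2.1 = Z g + v.1) ∨
      (B g % 3 = 2 ∧ (act g v).1 = X g + v.2.2.1 ∧ (act g v).2.1 = Y g + v.1 ∧
        (act g v).2.2.1 = Z g + v.2.1)) := by
  induction g using gen_induction with
  | one => simp [X, Y, Z, B, act_one]
  | ha g ih => simp only [X, Y, Z, B, act_mul, act_a] at ih ⊢; omega
  | hb g ih => simp only [X, Y, Z, B, act_mul, act_b] at ih ⊢; omega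
  | hc g ih => simp only [X, Y, Z, B, act_mul, act_c] at ih ⊢; omega

/-- The semidirect product law: the vector of `h` is rotated `B g` times before it is added to that
of `g`. -/
lemma coords_mul (g h : G) :
    B (g * h) = B g + B h ∧
    ((B g % 3 = 0 ∧ X (g * h) = X g + X h ∧ Y (g * h) = Y g + Y h ∧ Z (g * h) = Z g + Z h) ∨
      (B g % 3 = 1 ∧ X (g * h) = X g + Y h ∧ Y (g * h) = Y g + Z h ∧ Z (g * h) = Z g + X h) ∨
      (B g % 3 = 2 ∧ X (g * h) = X g + Z h ∧ Y (g * h) = Y g + X h ∧ Z (g * h) = Z g + Y h)) := by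
  have := act_apply g (act h (0, 0, 0, 0))
  rwa [← act_mul] at this

lemma hasCoords_one : HasCoords 1 0 0 0 0 := hasCoords_of_act (act_one _)

lemma hasCoords_a : HasCoords a 1 0 0 0 := hasCoords_of_act rfl

lemma hasCoords_b : HasCoords b 0 0 0 1 := hasCoords_of_act rfl

lemma hasCoords_c : HasCoords c 0 1 0 0 := hasCoords_of_act rfl

/-! ### Divisibility and transit elements in coordinates -/

/-- Left divisibility of the element with coordinates `(x', y', z', n')` by the one with
coordinates `(x, y, z, n)`. -/
def LeftDvdCoords (x y z n x' y' z' n' : ℕ) : Prop :=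
  x ≤ x' ∧ y ≤ y' ∧ z ≤ z' ∧
    (n < n' ∨ n = n' ∧ (n % 3 = 0 ∧ z = z' ∨ n % 3 = 1 ∧ y = y' ∨ n % 3 = 2 ∧ x = x'))

/-- The quotient is the difference of the vectors, rotated back by `B g`. When `B g = B h` it
contains no `b`, so its third coordinate must vanish. Depending on `B g` mod 3, that coordinate sits
in position `Z`, `Y` or `X`. -/
lemma leftDvd_iff (g h : G) :
    LeftDvd g h ↔ LeftDvdCoords (X g) (Y g) (Z g) (B g) (X h) (Y h) (Z h) (B h) := by
  unfold LeftDvdCoords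
  constructor
  · rintro ⟨d, rfl⟩
    have h1 := coords_mul g d
    have h2 := Z_eq_zero_of_B_eq_zero d
    omega
  · intro H
    obtain h0 | h1 | h2 : B g % 3 = 0 ∨ B g % 3 = 1 ∨ B g % 3 = 2 := by omega
    · obtain ⟨d, hx, hy, hz, hn⟩ := exists_hasCoords (X h - X g) (Y h - Y g)
        (Z h - Z g) (B h - B g) (by omega)
      refine ⟨d, (eq_iff_coords _ _).2 ?_⟩
      have := coords_mul g d
      omega
    · obtain ⟨d, hx, hy, hz, hn⟩ := exists_hasCoords (Z h - Z g) (X h - X g)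
        (Y h - Y g) (B h - B g) (by omega)
      refine ⟨d, (eq_iff_coords _ _).2 ?_⟩
      have := coords_mul g d
      omega
    · obtain ⟨d, hx, hy, hz, hn⟩ := exists_hasCoords (Y h - Y g) (Z h - Z g)
        (X h - X g) (B h - B g) (by omega)
      refine ⟨d, (eq_iff_coords _ _).2 ?_⟩
      have := coords_mul g d
      omega

/-- The element with coordinates `(x, y, z, n)` is a right transit element of the one with
coordinates `(p, q, r, k)`. -/
def TransCoords (p q r k x y z n : ℕ) : Prop :=
  (x ≠ 0 ∨ y ≠ 0 ∨ n ≠ 0) ∧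
    (k % 3 = 0 ∨ k % 3 = 1 ∧ x ≤ p + y ∧ y ≤ q + z ∧ z ≤ r + x ∨
      k % 3 = 2 ∧ x ≤ p + z ∧ y ≤ q + x ∧ z ≤ r + y) ∧
    (k = 0 → n % 3 = 0 ∨ n % 3 = 1 ∧ q = 0 ∨ n % 3 = 2 ∧ p = 0)

/-- Membership means that `A` left-divides `w * A`. The last clause of `TransCoords` is the rigid
coordinate of `leftDvd_iff`, which matters only when `w` has no letter `b`. -/
lemma mem_trans_iff (w A : G) :
    A ∈ Trans w ↔ TransCoords (X w) (Y w) (Z w) (B w) (X A) (Y A) (Z A) (B A) := by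
  have h1 : A ∈ Trans w ↔ A ≠ 1 ∧ LeftDvd A (w * A) :=
    and_congr_right fun _ => exists_congr fun _ => eq_comm
  rw [h1, Ne, hasCoords_one.eq_iff, leftDvd_iff, LeftDvdCoords, TransCoords]
  have h2 := coords_mul w A
  have h3 := Z_eq_zero_of_B_eq_zero A
  have h4 := Z_eq_zero_of_B_eq_zero w
  omega

lemma HasCoords.mem_transMin_iff {w : G} {p q r k : ℕ} (hw : HasCoords w p q r k) (A : G) :
    A ∈ TransMin w ↔
      (B A = 0 → Z A = 0) ∧ TransCoords p q r k (X A) (Y A) (Z A) (B A) ∧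
      ∀ x y z n, (n = 0 → z = 0) → TransCoords p q r k x y z n →
        LeftDvdCoords x y z n (X A) (Y A) (Z A) (B A) →
        x = X A ∧ y = Y A ∧ z = Z A ∧ n = B A := by
  obtain ⟨rfl, rfl, rfl, rfl⟩ := hw
  change _ ∧ _ ↔ _
  rw [mem_trans_iff]
  constructor
  · refine fun ⟨h1, h2⟩ => ⟨Z_eq_zero_of_B_eq_zero A, h1, fun x y z n hn hT hD => ?_⟩
    obtain ⟨D, hc⟩ := exists_hasCoords x y z n hn
    have := h2 D
    rw [mem_trans_iff, leftDvd_iff, eq_iff_coords, hc.1, hc.2.1, hc.2.2.1, hc.2.2.2] at this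
    exact this hT hD
  · refine fun ⟨_, h1, h2⟩ => ⟨h1, fun D hD hDA => ?_⟩
    rw [mem_trans_iff] at hD
    rw [leftDvd_iff] at hDA
    exact (eq_iff_coords _ _).2 (h2 _ _ _ _ (Z_eq_zero_of_B_eq_zero D) hD hDA)

/-! ### Normal forms with few letters `b` -/

lemma B_ofWord (x : List (Fin 3)) : B (ofWord x) = x.count 1 := by
  induction x with
  | nil => rfl
  | cons s x ih =>
    rw [ofWord_cons]
    have := (coords_mul (gen s) (ofWord x)).1
    fin_cases s
    · have h : B (gen 0) = 0 := rfl
      simp_all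
    · have h : B (gen 1) = 1 := rfl
      simp_all [add_comm]
    · have h : B (gen 2) = 0 := rfl
      simp_all

lemma mem_W_iff (j : ℕ) (w : G) : w ∈ W j ↔ B w = j := by
  constructor
  · rintro ⟨x, rfl, hx⟩
    rw [B_ofWord, hx]
  · intro h
    obtain ⟨x, rfl⟩ := exists_ofWord w
    exact ⟨x, rfl, B_ofWord x ▸ h⟩

lemma hasCoords_W_zero (p q : ℕ) : HasCoords (a ^ p * c ^ q) p q 0 0 :=
  hasCoords_of_act (by simp [act_mul, act_a_pow, act_c_pow])

lemma hasCoords_W_one (p q r : ℕ) : HasCoords (a ^ p * c ^ q * b * a ^ r) p q r 1 :=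
  hasCoords_of_act (by simp [act_mul, act_a_pow, act_c_pow, act_b])

lemma hasCoords_W_two (p q r : ℕ) : HasCoords (a ^ p * c ^ q * b * b * c ^ r) p q r 2 :=
  hasCoords_of_act (by simp [act_mul, act_a_pow, act_c_pow, act_b])

lemma hasCoords_W_three (p q r : ℕ) : HasCoords (a ^ p * c ^ q * b * a ^ r * b * b) p q r 3 :=
  hasCoords_of_act (by simp [act_mul, act_a_pow, act_c_pow, act_b])

lemma mem_W_zero_iff (w : G) : w ∈ W 0 ↔ ∃ p q : ℕ, w = a ^ p * c ^ q := by
  simp only [mem_W_iff, (hasCoords_W_zero _ _).eq_iff]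
  exact ⟨fun h => ⟨X w, Y w, rfl, rfl, Z_eq_zero_of_B_eq_zero w h, h⟩,
    fun ⟨_, _, _, _, _, h⟩ => h⟩

lemma mem_W_one_iff (w : G) : w ∈ W 1 ↔ ∃ p q r : ℕ, w = a ^ p * c ^ q * b * a ^ r := by
  simp only [mem_W_iff, (hasCoords_W_one _ _ _).eq_iff]
  exact ⟨fun h => ⟨X w, Y w, Z w, rfl, rfl, rfl, h⟩, fun ⟨_, _, _, _, _, _, h⟩ => h⟩

lemma mem_W_two_iff (w : G) : w ∈ W 2 ↔ ∃ p q r : ℕ, w = a ^ p * c ^ q * b * b * c ^ r := by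
  simp only [mem_W_iff, (hasCoords_W_two _ _ _).eq_iff]
  exact ⟨fun h => ⟨X w, Y w, Z w, rfl, rfl, rfl, h⟩, fun ⟨_, _, _, _, _, _, h⟩ => h⟩

lemma mem_W_three_iff (w : G) :
    w ∈ W 3 ↔ ∃ p q r : ℕ, w = a ^ p * c ^ q * b * a ^ r * b * b := by
  simp only [mem_W_iff, (hasCoords_W_three _ _ _).eq_iff]
  exact ⟨fun h => ⟨X w, Y w, Z w, rfl, rfl, rfl, h⟩, fun ⟨_, _, _, _, _, _, h⟩ => h⟩

/-! ### Failure of the LCM conditions -/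

/-- Both `u = cbb` and `v = acbb` are common right multiples of `b` and `c`. A least one would need
exactly two letters `b`; its first coordinate would then be rigid, hence equal to those of both `u`
and `v`, which differ. -/
lemma not_rightLCMCondition : ¬ RightLCMCondition := by
  intro H
  obtain ⟨m, hb, hc, hm⟩ := H b c
  obtain ⟨u, hu⟩ := exists_hasCoords 0 1 0 2 (by simp)
  obtain ⟨v, hv⟩ := exists_hasCoords 1 1 0 2 (by simp)
  have h1 := hm u
  have h2 := hm v
  simp only [leftDvd_iff, LeftDvdCoords, HasCoords] at *
  have h3 := hasCoords_b
  have h4 := hasCoords_c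
  simp only [HasCoords] at h3 h4
  omega

lemma rightDvd_iff_exists_coords (g h : G) :
    RightDvd g h ↔ ∃ x y z n : ℕ, (n = 0 → z = 0) ∧ B h = n + B g ∧
    (n % 3 = 0 ∧ X h = x + X g ∧ Y h = y + Y g ∧ Z h = z + Z g ∨
      n % 3 = 1 ∧ X h = x + Y g ∧ Y h = y + Z g ∧ Z h = z + X g ∨
      n % 3 = 2 ∧ X h = x + Z g ∧ Y h = y + X g ∧ Z h = z + Y g) := by
  constructor
  · rintro ⟨d, rfl⟩
    exact ⟨X d, Y d, Z d, B d, Z_eq_zero_of_B_eq_zero d, coords_mul d g⟩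
  · rintro ⟨x, y, z, n, hn, H⟩
    obtain ⟨d, rfl, rfl, rfl, rfl⟩ := exists_hasCoords x y z n hn
    refine ⟨d, (eq_iff_coords _ _).2 ?_⟩
    have := coords_mul d g
    omega

/-- Here `u = cbb` and `v = cbab` are common left multiples of `a` and `b` with different `Z`. A
left quotient without `b` leaves `Z` unchanged, so no `m` with two letters `b` right-divides both.
With one letter `b`, divisibility by `b` forces `Z m = 0` and divisibility by `a` forces `Z m ≥ 1`.
-/
lemma not_leftLCMCondition : ¬ LeftLCMCondition := by
  intro H
  obtain ⟨m, ha, hb, hm⟩ := H a b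
  obtain ⟨u, hu⟩ := exists_hasCoords 0 1 0 2 (by simp)
  obtain ⟨v, hv⟩ := exists_hasCoords 0 1 1 2 (by simp)
  have h3 := hasCoords_a
  have h4 := hasCoords_b
  simp only [HasCoords] at *
  have h1 := hm u ((rightDvd_iff_exists_coords _ _).2 ⟨0, 0, 0, 2, by omega⟩)
    ((rightDvd_iff_exists_coords _ _).2 ⟨0, 1, 0, 1, by omega⟩)
  have h2 := hm v ((rightDvd_iff_exists_coords _ _).2 ⟨0, 0, 1, 2, by omega⟩)
    ((rightDvd_iff_exists_coords _ _).2 ⟨0, 1, 1, 1, by omega⟩)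
  rw [rightDvd_iff_exists_coords] at ha hb h1 h2
  obtain ⟨x1, y1, z1, n1, h1⟩ := h1
  obtain ⟨x2, y2, z2, n2, h2⟩ := h2
  obtain ⟨x3, y3, z3, n3, ha⟩ := ha
  obtain ⟨x4, y4, z4, n4, hb⟩ := hb
  have h5 : B m ≤ 2 := by omega
  obtain h | h | h : B m = 0 ∨ B m = 1 ∨ B m = 2 := by omega
  · omega
  · obtain rfl : n4 = 0 := by omega
    obtain rfl : n3 = 1 := by omega
    omega
  · obtain rfl : n1 = 0 := by omega
    obtain rfl : n2 = 0 := by omega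
    obtain rfl : n3 = 2 := by omega
    omega

/-! ### The elements `Δ i` -/

lemma hasCoords_Δ (i : ℕ) : HasCoords (Δ i) i i i 3 := by
  apply hasCoords_of_act
  simp [Δ, pow_three, act_mul, act_c_pow, act_b]

lemma hasCoords_gen_cases (s : Fin 3) :
    HasCoords (gen s) 1 0 0 0 ∨ HasCoords (gen s) 0 0 0 1 ∨ HasCoords (gen s) 0 1 0 0 := by
  fin_cases s
  · exact .inl hasCoords_a
  · exact .inr (.inl hasCoords_b)
  · exact .inr (.inr hasCoords_c)

lemma isQuasiCentral_Δ_zero : IsQuasiCentral (Δ 0) := by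
  refine ⟨1, fun s => (eq_iff_coords _ _).2 ?_⟩
  have h1 := hasCoords_Δ 0
  have h2 := coords_mul (gen s) (Δ 0)
  have h3 := coords_mul (Δ 0) (gen s)
  have h4 := hasCoords_gen_cases s
  simp only [HasCoords, Equiv.Perm.coe_one, id_eq] at *
  omega

/-- Compare second coordinates in `c D = D σ(c)`: the left one is 1, while the right one is the `Z`
of a letter, which is 0. This rules out a factor with one `b` in a splitting of `bbb`. -/
lemma IsQuasiCentral.B_ne_one {D : G} (hD : IsQuasiCentral D) (hX : X D = 0) (hY : Y D = 0) :
    B D ≠ 1 := by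
  intro hB
  obtain ⟨σ, hσ⟩ := hD
  have h1 := (eq_iff_coords _ _).1 (hσ 2)
  have h2 := coords_mul (gen 2) D
  have h3 := coords_mul D (gen (σ 2))
  have h4 := hasCoords_gen_cases (σ 2)
  have h5 : HasCoords (gen 2) 0 1 0 0 := hasCoords_c
  simp only [HasCoords] at *
  have := Z_eq_zero_of_B_eq_zero (gen (σ 2))
  omega

lemma isIndecomposableQuasiCentral_Δ_zero : IsIndecomposableQuasiCentral (Δ 0) := by
  have h0 := hasCoords_Δ 0
  refine ⟨isQuasiCentral_Δ_zero, ?_, fun x y hx hy h => ?_⟩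
  · rw [Ne, hasCoords_one.eq_iff]
    simp only [HasCoords] at h0
    omega
  · rw [hasCoords_one.eq_iff, hasCoords_one.eq_iff]
    have h1 := hx.B_ne_one
    have h2 := hy.B_ne_one
    have h3 := coords_mul x y
    rw [← h] at h3
    simp only [HasCoords] at h0
    omega

lemma not_isFundamental_Δ_zero : ¬ IsFundamental (Δ 0) := by
  rintro ⟨σ, hσ⟩
  obtain ⟨E, hE, -⟩ := hσ 0
  have h1 : HasCoords (gen 0) 1 0 0 0 := hasCoords_a
  have h2 := coords_mul (gen 0) E
  have h3 := hasCoords_Δ 0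
  rw [← hE] at h2
  simp only [HasCoords] at *
  omega

lemma isFundamental_Δ {i : ℕ} (hi : 1 ≤ i) : IsFundamental (Δ i) := by
  have h0 := hasCoords_Δ i
  refine ⟨1, fun s => ?_⟩
  simp only [Equiv.Perm.coe_one, id_eq]
  have hs := hasCoords_gen_cases s
  have key : ∀ x y z n, (n = 0 → z = 0) → (∀ E, HasCoords E x y z n →
      Δ i = gen s * E ∧ Δ i = E * gen s) → ∃ E, Δ i = gen s * E ∧ Δ i = E * gen s := by
    intro x y z n hn h
    obtain ⟨E, hE⟩ := exists_hasCoords x y z n hn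
    exact ⟨E, h E hE⟩
  simp only [eq_iff_coords, HasCoords] at *
  obtain hs | hs | hs := hs
  · refine key (i - 1) i i 3 (by omega) fun E hE => ?_
    have h1 := coords_mul (gen s) E
    have h2 := coords_mul E (gen s)
    omega
  · refine key i i i 2 (by omega) fun E hE => ?_
    have h1 := coords_mul (gen s) E
    have h2 := coords_mul E (gen s)
    omega
  · refine key i (i - 1) i 3 (by omega) fun E hE => ?_
    have h1 := coords_mul (gen s) E
    have h2 := coords_mul E (gen s)
    omega

/-- Counting letters `b` gives `σ(b) = b`, and `b E = E b` makes the vector rotation invariant. It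
is nonzero because `a` divides `D`, so `B D = 1` is impossible: `E` would have no `b` and `Z E = 0`.
If `B D = 2`, right multiplication by `σ(a)`, which is `a` or `c`, raises `Y` or `Z` and never `X`.
-/
lemma IsFundamental.coords {D : G} (hD : IsFundamental D) (hB : B D ≤ 3) :
    X D = Y D ∧ Y D = Z D ∧ B D = 3 := by
  obtain ⟨σ, hσ⟩ := hD
  obtain ⟨E, hE1, hE2⟩ := hσ 1
  obtain ⟨F, hF1, hF2⟩ := hσ 0
  have h1 : HasCoords (gen 1) 0 0 0 1 := hasCoords_b
  have h2 : HasCoords (gen 0) 1 0 0 0 := hasCoords_a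
  have h3 := coords_mul (gen 1) E
  have h4 := coords_mul E (gen (σ 1))
  have h5 := coords_mul (gen 0) F
  have h6 := coords_mul F (gen (σ 0))
  have h7 := hasCoords_gen_cases (σ 1)
  have h8 := hasCoords_gen_cases (σ 0)
  rw [← hE1] at h3
  rw [← hE2] at h4
  rw [← hF1] at h5
  rw [← hF2] at h6
  have h9 := Z_eq_zero_of_B_eq_zero E
  simp only [HasCoords] at *
  have hσ1 : X (gen (σ 1)) = 0 ∧ Y (gen (σ 1)) = 0 ∧ Z (gen (σ 1)) = 0 ∧ B (gen (σ 1)) = 1 := by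
    omega
  have hE : B D = B E + 1 ∧ X D = X E ∧ Y D = Y E ∧ Z D = Z E ∧ X D = Y D ∧ Y D = Z D := by omega
  clear h3 h4 h7
  obtain h | h | h | h : B D = 0 ∨ B D = 1 ∨ B D = 2 ∨ B D = 3 := by omega
  all_goals omega

lemma isMinimalFundamental_Δ {i : ℕ} (hi : 1 ≤ i) : IsMinimalFundamental (Δ i) := by
  have h0 := hasCoords_Δ i
  refine ⟨isFundamental_Δ hi, fun D hD h => h0.eq_iff D |>.2 ?_⟩
  have h1 := hD.coords
  simp only [HasCoords] at h0
  obtain h | h := h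
  -- Both elements have three letters `b`, so `Z` is rigid and fixes the common value of the
  -- coordinates.
  · rw [leftDvd_iff, LeftDvdCoords] at h
    omega
  · obtain ⟨x, y, z, n, hn, h⟩ := (rightDvd_iff_exists_coords _ _).1 h
    obtain rfl : n = 0 := by omega
    omega

/-! ### Right minimal transit elements -/

lemma hasCoords_b_mul_b : HasCoords (b * b) 0 0 0 2 := hasCoords_of_act rfl

lemma hasCoords_b_mul_b_mul_c_pow_mul_b (i : ℕ) : HasCoords (b * b * c ^ i * b) 0 0 i 3 :=
  hasCoords_of_act (by simp [act_mul, act_c_pow, act_b])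

lemma hasCoords_c_pow_mul_b_mul_a_pow (i : ℕ) : HasCoords (c ^ i * b * a ^ i) 0 i i 1 := by
  simpa using hasCoords_W_one 0 i i

lemma transCoords_zero (p q x y z n : ℕ) :
    TransCoords p q 0 0 x y z n ↔ (x ≠ 0 ∨ y ≠ 0 ∨ n ≠ 0) ∧
      (n % 3 = 0 ∨ n % 3 = 1 ∧ q = 0 ∨ n % 3 = 2 ∧ p = 0) := by
  simp [TransCoords]

lemma transCoords_one (p q r x y z n : ℕ) :
    TransCoords p q r 1 x y z n ↔ (x ≠ 0 ∨ y ≠ 0 ∨ n ≠ 0) ∧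
      x ≤ p + y ∧ y ≤ q + z ∧ z ≤ r + x := by
  simp [TransCoords]

lemma transCoords_two (p q r x y z n : ℕ) :
    TransCoords p q r 2 x y z n ↔ (x ≠ 0 ∨ y ≠ 0 ∨ n ≠ 0) ∧
      x ≤ p + z ∧ y ≤ q + x ∧ z ≤ r + y := by
  simp [TransCoords]

lemma transCoords_three (p q r x y z n : ℕ) :
    TransCoords p q r 3 x y z n ↔ x ≠ 0 ∨ y ≠ 0 ∨ n ≠ 0 := by
  simp [TransCoords]

section
variable {x y z n : ℕ}

lemma eq_zero_or_eq_a (h0 : n = 0 → z = 0)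
    (h : LeftDvdCoords 1 0 0 0 x y z n → 1 = x ∧ 0 = y ∧ 0 = z ∧ 0 = n) :
    x = 0 ∨ x = 1 ∧ y = 0 ∧ z = 0 ∧ n = 0 := by
  unfold LeftDvdCoords at h
  omega

lemma eq_zero_or_eq_c (h0 : n = 0 → z = 0)
    (h : LeftDvdCoords 0 1 0 0 x y z n → 0 = x ∧ 1 = y ∧ 0 = z ∧ 0 = n) :
    y = 0 ∨ x = 0 ∧ y = 1 ∧ z = 0 ∧ n = 0 := by
  unfold LeftDvdCoords at h
  omega

/-- An element with a single `b` escapes division by `b` as soon as `y ≠ 0`. The two lemmas that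
follow have analogous escapes, and these are where infinite families can arise. -/
lemma eq_zero_or_eq_b (h : LeftDvdCoords 0 0 0 1 x y z n → 0 = x ∧ 0 = y ∧ 0 = z ∧ 1 = n) :
    n = 0 ∨ n = 1 ∧ y ≠ 0 ∨ x = 0 ∧ y = 0 ∧ z = 0 ∧ n = 1 := by
  unfold LeftDvdCoords at h
  omega

lemma le_one_or_eq_b_mul_b
    (h : LeftDvdCoords 0 0 0 2 x y z n → 0 = x ∧ 0 = y ∧ 0 = z ∧ 2 = n) :
    n ≤ 1 ∨ n = 2 ∧ x ≠ 0 ∨ x = 0 ∧ y = 0 ∧ z = 0 ∧ n = 2 := by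
  unfold LeftDvdCoords at h
  omega

lemma le_two_or_eq_b_pow_three
    (h : LeftDvdCoords 0 0 0 3 x y z n → 0 = x ∧ 0 = y ∧ 0 = z ∧ 3 = n) :
    n ≤ 2 ∨ n = 3 ∧ z ≠ 0 ∨ x = 0 ∧ y = 0 ∧ z = 0 ∧ n = 3 := by
  unfold LeftDvdCoords at h
  omega

/-- Left divisibility of elements with a single letter `b` and the same exponent of `c`. -/
lemma leftDvdCoords_one {x' z' : ℕ} (hx : x' ≤ x) (hz : z' ≤ z) :
    LeftDvdCoords x' y z' 1 x y z 1 := by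
  unfold LeftDvdCoords
  omega

end

section
variable {w : G} {p q r : ℕ}

lemma transMin_one : TransMin 1 = {a, b, c} := by
  ext A
  rw [hasCoords_one.mem_transMin_iff]
  simp only [Set.mem_insert_iff, Set.mem_singleton_iff, hasCoords_a.eq_iff, hasCoords_b.eq_iff,
    hasCoords_c.eq_iff, transCoords_zero, and_true]
  constructor
  · rintro ⟨h0, h1, h2⟩
    have ha := eq_zero_or_eq_a h0 (h2 1 0 0 0 (by omega) (by omega))
    have hb := eq_zero_or_eq_b (h2 0 0 0 1 (by omega) (by omega))
    have hc := eq_zero_or_eq_c h0 (h2 0 1 0 0 (by omega) (by omega))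
    omega
  · intro h
    refine ⟨by omega, by omega, fun x y z n _ _ hd => ?_⟩
    unfold LeftDvdCoords at hd
    omega

lemma transMin_c_pow (hq : 1 ≤ q) : TransMin (c ^ q) = {a, c, b * b} := by
  have hw : HasCoords (c ^ q) 0 q 0 0 := by simpa using hasCoords_W_zero 0 q
  ext A
  rw [hw.mem_transMin_iff]
  simp only [Set.mem_insert_iff, Set.mem_singleton_iff, hasCoords_a.eq_iff,
    hasCoords_b_mul_b.eq_iff, hasCoords_c.eq_iff, transCoords_zero, and_true]
  constructor
  · rintro ⟨h0, h1, h2⟩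
    have ha := eq_zero_or_eq_a h0 (h2 1 0 0 0 (by omega) (by omega))
    have hb := le_one_or_eq_b_mul_b (h2 0 0 0 2 (by omega) (by omega))
    have hc := eq_zero_or_eq_c h0 (h2 0 1 0 0 (by omega) (by omega))
    omega
  · intro h
    refine ⟨by omega, by omega, fun x y z n _ _ hd => ?_⟩
    unfold LeftDvdCoords at hd
    omega

lemma transMin_a_pow (hp : 1 ≤ p) : TransMin (a ^ p) = {a, b, c} := by
  have hw : HasCoords (a ^ p) p 0 0 0 := by simpa using hasCoords_W_zero p 0
  ext A
  rw [hw.mem_transMin_iff]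
  simp only [Set.mem_insert_iff, Set.mem_singleton_iff, hasCoords_a.eq_iff, hasCoords_b.eq_iff,
    hasCoords_c.eq_iff, transCoords_zero, and_true]
  constructor
  · rintro ⟨h0, h1, h2⟩
    have ha := eq_zero_or_eq_a h0 (h2 1 0 0 0 (by omega) (by omega))
    have hb := eq_zero_or_eq_b (h2 0 0 0 1 (by omega) (by omega))
    have hc := eq_zero_or_eq_c h0 (h2 0 1 0 0 (by omega) (by omega))
    omega
  · intro h
    refine ⟨by omega, by omega, fun x y z n _ _ hd => ?_⟩
    unfold LeftDvdCoords at hd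
    omega

lemma transMin_a_pow_mul_c_pow (hp : 1 ≤ p) (hq : 1 ≤ q) :
    TransMin (a ^ p * c ^ q) = {a, c} ∪ {u | ∃ i : ℕ, u = b * b * c ^ i * b} := by
  ext A
  rw [(hasCoords_W_zero p q).mem_transMin_iff]
  change _ ↔ (_ ∨ ∃ i : ℕ, _)
  simp only [Set.mem_insert_iff, Set.mem_singleton_iff, hasCoords_a.eq_iff, hasCoords_c.eq_iff,
    (hasCoords_b_mul_b_mul_c_pow_mul_b _).eq_iff, transCoords_zero]
  constructor
  · rintro ⟨h0, h1, h2⟩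
    have ha := eq_zero_or_eq_a h0 (h2 1 0 0 0 (by omega) (by omega))
    have hb := le_two_or_eq_b_pow_three (h2 0 0 0 3 (by omega) (by omega))
    have hc := eq_zero_or_eq_c h0 (h2 0 1 0 0 (by omega) (by omega))
    by_cases hA : B A = 0
    · left; omega
    · right; exact ⟨Z A, by omega⟩
  · rintro (h | ⟨i, h⟩)
    · refine ⟨by omega, by omega, fun x y z n _ _ hd => ?_⟩
      unfold LeftDvdCoords at hd
      omega
    · refine ⟨by omega, by omega, fun x y z n _ _ hd => ?_⟩
      unfold LeftDvdCoords at hd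
      omega

lemma HasCoords.transMin_one_zero_pos (hw : HasCoords w 0 q r 1) (hq : 1 ≤ q) :
    TransMin w = {b, c} := by
  ext A
  rw [hw.mem_transMin_iff]
  simp only [Set.mem_insert_iff, Set.mem_singleton_iff, hasCoords_b.eq_iff,
    hasCoords_c.eq_iff, transCoords_one]
  constructor
  · rintro ⟨h0, h1, h2⟩
    have hb := eq_zero_or_eq_b (h2 0 0 0 1 (by omega) (by omega))
    have hc := eq_zero_or_eq_c h0 (h2 0 1 0 0 (by omega) (by omega))
    omega
  · intro h
    refine ⟨by omega, by omega, fun x y z n _ _ hd => ?_⟩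
    unfold LeftDvdCoords at hd
    omega

lemma HasCoords.transMin_one_pos_zero (hw : HasCoords w p 0 r 1) (hp : 1 ≤ p) :
    TransMin w = {a} ∪ {u | ∃ i : ℕ, i ≤ r ∧ u = c ^ i * b * a ^ i} := by
  ext A
  rw [hw.mem_transMin_iff]
  change _ ↔ (_ ∨ ∃ i : ℕ, _)
  simp only [Set.mem_singleton_iff, hasCoords_a.eq_iff,
    (hasCoords_c_pow_mul_b_mul_a_pow _).eq_iff, transCoords_one]
  constructor
  · rintro ⟨h0, h1, h2⟩
    have ha := eq_zero_or_eq_a h0 (h2 1 0 0 0 (by omega) (by omega))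
    have hb := eq_zero_or_eq_b (h2 0 0 0 1 (by omega) (by omega))
    by_cases hA : B A = 0
    · left; omega
    · have hB : B A = 1 := by omega
      -- For fixed rigid `Y A`, this is the smallest transit element: the transit inequalities
      -- include `y ≤ z`.
      have hc := h2 0 (Y A) (Y A) 1 (by omega) (by omega)
        (by rw [hB]; exact leftDvdCoords_one (by omega) (by omega))
      right; exact ⟨Y A, by omega⟩
  · rintro (h | ⟨i, h⟩)
    · refine ⟨by omega, by omega, fun x y z n _ _ hd => ?_⟩
      unfold LeftDvdCoords at hd
      omega
    · refine ⟨by omega, by omega, fun x y z n _ _ hd => ?_⟩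
      unfold LeftDvdCoords at hd
      omega

lemma HasCoords.transMin_one_pos_pos (hw : HasCoords w p q r 1) (hp : 1 ≤ p) (hq : 1 ≤ q) :
    TransMin w = {a, b, c} := by
  ext A
  rw [hw.mem_transMin_iff]
  simp only [Set.mem_insert_iff, Set.mem_singleton_iff, hasCoords_a.eq_iff, hasCoords_b.eq_iff,
    hasCoords_c.eq_iff, transCoords_one]
  constructor
  · rintro ⟨h0, h1, h2⟩
    have ha := eq_zero_or_eq_a h0 (h2 1 0 0 0 (by omega) (by omega))
    have hb := eq_zero_or_eq_b (h2 0 0 0 1 (by omega) (by omega))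
    have hc := eq_zero_or_eq_c h0 (h2 0 1 0 0 (by omega) (by omega))
    omega
  · intro h
    refine ⟨by omega, by omega, fun x y z n _ _ hd => ?_⟩
    unfold LeftDvdCoords at hd
    omega

lemma HasCoords.transMin_two_pos_pos (hw : HasCoords w p q r 2) (hp : 1 ≤ p) (hq : 1 ≤ q) :
    TransMin w = {a, b, c} := by
  ext A
  rw [hw.mem_transMin_iff]
  simp only [Set.mem_insert_iff, Set.mem_singleton_iff, hasCoords_a.eq_iff, hasCoords_b.eq_iff,
    hasCoords_c.eq_iff, transCoords_two]
  constructor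
  · rintro ⟨h0, h1, h2⟩
    have ha := eq_zero_or_eq_a h0 (h2 1 0 0 0 (by omega) (by omega))
    have hb := eq_zero_or_eq_b (h2 0 0 0 1 (by omega) (by omega))
    have hc := eq_zero_or_eq_c h0 (h2 0 1 0 0 (by omega) (by omega))
    omega
  · intro h
    refine ⟨by omega, by omega, fun x y z n _ _ hd => ?_⟩
    unfold LeftDvdCoords at hd
    omega

lemma HasCoords.transMin_one_zero_zero (hw : HasCoords w 0 0 r 1) :
    TransMin w = {u | ∃ i : ℕ, i ≤ r ∧ u = c ^ i * b * a ^ i} ∪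
      {u | ∃ i : ℕ, r + 1 ≤ i ∧ u = a ^ (i - r) * c ^ i * b * a ^ i} := by
  ext A
  rw [hw.mem_transMin_iff]
  change _ ↔ ((∃ i : ℕ, _) ∨ ∃ i : ℕ, _)
  simp only [(hasCoords_W_one _ _ _).eq_iff,
    (hasCoords_c_pow_mul_b_mul_a_pow _).eq_iff, transCoords_one]
  constructor
  · rintro ⟨h0, h1, h2⟩
    have hb := eq_zero_or_eq_b (h2 0 0 0 1 (by omega) (by omega))
    have hB : B A = 1 := by omega
    -- The inequalities are `x ≤ y ≤ z ≤ r + x`. For fixed `y` the least solution has `z = y` and `x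
    -- = y - r`; truncated subtraction covers `y ≤ r`.
    have hc := h2 (Y A - r) (Y A) (Y A) 1 (by omega) (by omega)
      (by rw [hB]; exact leftDvdCoords_one (by omega) (by omega))
    by_cases hA : Y A ≤ r
    · left; exact ⟨Y A, by omega⟩
    · right; exact ⟨Y A, by omega⟩
  · rintro (⟨i, h⟩ | ⟨i, h⟩)
    · refine ⟨by omega, by omega, fun x y z n _ _ hd => ?_⟩
      unfold LeftDvdCoords at hd
      omega
    · refine ⟨by omega, by omega, fun x y z n _ _ hd => ?_⟩
      unfold LeftDvdCoords at hd
      omega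

lemma HasCoords.transMin_two_zero_pos (hw : HasCoords w 0 q r 2) (hq : 1 ≤ q) :
    TransMin w = {b, c} := by
  ext A
  rw [hw.mem_transMin_iff]
  simp only [Set.mem_insert_iff, Set.mem_singleton_iff, hasCoords_b.eq_iff,
    hasCoords_c.eq_iff, transCoords_two]
  constructor
  · rintro ⟨h0, h1, h2⟩
    have hb := eq_zero_or_eq_b (h2 0 0 0 1 (by omega) (by omega))
    have hc := eq_zero_or_eq_c h0 (h2 0 1 0 0 (by omega) (by omega))
    omega
  · intro h
    refine ⟨by omega, by omega, fun x y z n _ _ hd => ?_⟩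
    unfold LeftDvdCoords at hd
    omega

lemma HasCoords.transMin_two_pos_zero (hw : HasCoords w p 0 r 2) (hp : 1 ≤ p) :
    TransMin w = {a, b} := by
  ext A
  rw [hw.mem_transMin_iff]
  simp only [Set.mem_insert_iff, Set.mem_singleton_iff, hasCoords_a.eq_iff,
    hasCoords_b.eq_iff, transCoords_two]
  constructor
  · rintro ⟨h0, h1, h2⟩
    have ha := eq_zero_or_eq_a h0 (h2 1 0 0 0 (by omega) (by omega))
    have hb := eq_zero_or_eq_b (h2 0 0 0 1 (by omega) (by omega))
    omega
  · intro h
    refine ⟨by omega, by omega, fun x y z n _ _ hd => ?_⟩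
    unfold LeftDvdCoords at hd
    omega

lemma HasCoords.transMin_two_zero_zero (hw : HasCoords w 0 0 r 2) :
    TransMin w = {u | ∃ i : ℕ, u = a ^ i * c ^ i * b * a ^ i} := by
  ext A
  rw [hw.mem_transMin_iff]
  change _ ↔ ∃ i : ℕ, _
  simp only [(hasCoords_W_one _ _ _).eq_iff, transCoords_two]
  constructor
  · rintro ⟨h0, h1, h2⟩
    have hb := eq_zero_or_eq_b (h2 0 0 0 1 (by omega) (by omega))
    have hB : B A = 1 := by omega
    -- Now the inequalities are `y ≤ x ≤ z ≤ r + y`, whose least solution for fixed `y` is constant.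
    have hc := h2 (Y A) (Y A) (Y A) 1 (by omega) (by omega)
      (by rw [hB]; exact leftDvdCoords_one (by omega) (by omega))
    exact ⟨Y A, by omega⟩
  · rintro ⟨i, h⟩
    refine ⟨by omega, by omega, fun x y z n _ _ hd => ?_⟩
    unfold LeftDvdCoords at hd
    omega

lemma HasCoords.transMin_three (hw : HasCoords w p q r 3) : TransMin w = {a, b, c} := by
  ext A
  rw [hw.mem_transMin_iff]
  simp only [Set.mem_insert_iff, Set.mem_singleton_iff, hasCoords_a.eq_iff, hasCoords_b.eq_iff,
    hasCoords_c.eq_iff, transCoords_three]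
  constructor
  · rintro ⟨h0, h1, h2⟩
    have ha := eq_zero_or_eq_a h0 (h2 1 0 0 0 (by omega) (by omega))
    have hb := eq_zero_or_eq_b (h2 0 0 0 1 (by omega) (by omega))
    have hc := eq_zero_or_eq_c h0 (h2 0 1 0 0 (by omega) (by omega))
    omega
  · intro h
    refine ⟨by omega, by omega, fun x y z n _ _ hd => ?_⟩
    unfold LeftDvdCoords at hd
    omega

end

lemma exists_leftDvd_Δ_of_mem_transMin {w u : G} (hu : u ∈ TransMin w) :
    ∃ i : ℕ, LeftDvd u (Δ i) := by
  have hw : HasCoords w (X w) (Y w) (Z w) (B w) := ⟨rfl, rfl, rfl, rfl⟩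
  rw [hw.mem_transMin_iff] at hu
  refine ⟨X u + Y u + Z u, ?_⟩
  obtain ⟨h1, h2, h3, h4⟩ := hasCoords_Δ (X u + Y u + Z u)
  rw [leftDvd_iff, h1, h2, h3, h4]
  clear h1 h2 h3 h4
  obtain ⟨h0, -, hM⟩ := hu
  -- The element `bbb` is central, hence a transit element of every `w`, so `B u ≤ 3`.
  have hd := le_two_or_eq_b_pow_three (hM 0 0 0 3 (by omega) (by unfold TransCoords; omega))
  -- When `B u = 3` the coordinate `Z` is rigid, so `Z u` must equal the chosen index `X u + Y u + Z
  -- u`.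
  have key : B u = 3 → X u = 0 ∧ Y u = 0 := by
    intro h3
    obtain hk | hk := Nat.eq_zero_or_pos (B w)
    · have ha := eq_zero_or_eq_a h0 (hM 1 0 0 0 (by omega) (by unfold TransCoords; omega))
      have hc := eq_zero_or_eq_c h0 (hM 0 1 0 0 (by omega) (by unfold TransCoords; omega))
      omega
    · have hb := eq_zero_or_eq_b (hM 0 0 0 1 (by omega) (by unfold TransCoords; omega))
      omega
  unfold LeftDvdCoords
  omega

/-! ### Solvability of the conjugacy problem -/

/-- The coordinate form of the condition that `A U = V A` for some `A`. -/
def ConjCoords (u v : ℕ × ℕ × ℕ × ℕ) : Prop :=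
  u.2.2.2 = v.2.2.2 ∧
    (u.2.2.2 % 3 = 0 ∧ (u.1 = v.1 ∧ u.2.1 = v.2.1 ∧ u.2.2.1 = v.2.2.1 ∨
        u.2.1 = v.1 ∧ u.2.2.1 = v.2.1 ∧ u.1 = v.2.2.1 ∨
        u.2.2.1 = v.1 ∧ u.1 = v.2.1 ∧ u.2.1 = v.2.2.1) ∨
      u.2.2.2 % 3 ≠ 0 ∧ u.1 + u.2.1 + u.2.2.1 = v.1 + v.2.1 + v.2.2.1)

lemma exists_mul_eq_mul_iff (U V : G) :
    (∃ A : G, A * U = V * A) ↔ ConjCoords (act U (0, 0, 0, 0)) (act V (0, 0, 0, 0)) := by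
  change _ ↔ B U = B V ∧ (B U % 3 = 0 ∧ (X U = X V ∧ Y U = Y V ∧ Z U = Z V ∨
        Y U = X V ∧ Z U = Y V ∧ X U = Z V ∨ Z U = X V ∧ X U = Y V ∧ Y U = Z V) ∨
      B U % 3 ≠ 0 ∧ X U + Y U + Z U = X V + Y V + Z V)
  simp only [eq_iff_coords]
  constructor
  · rintro ⟨A, hA⟩
    have h1 := coords_mul A U
    have h2 := coords_mul V A
    have h3 : B U = B V := by omega
    obtain h | h | h : B U % 3 = 0 ∨ B U % 3 = 1 ∨ B U % 3 = 2 := by omega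
    · refine ⟨h3, .inl ⟨h, ?_⟩⟩
      rw [← h3] at h2
      simp only [h] at h2
      omega
    · refine ⟨h3, .inr ⟨by omega, ?_⟩⟩
      rw [← h3] at h2
      simp only [h] at h2
      omega
    · refine ⟨h3, .inr ⟨by omega, ?_⟩⟩
      rw [← h3] at h2
      simp only [h] at h2
      omega
  · have key : ∀ x y z n, (n = 0 → z = 0) → (∀ A, HasCoords A x y z n →
        X (A * U) = X (V * A) ∧ Y (A * U) = Y (V * A) ∧ Z (A * U) = Z (V * A) ∧
          B (A * U) = B (V * A)) →
        ∃ A, X (A * U) = X (V * A) ∧ Y (A * U) = Y (V * A) ∧ Z (A * U) = Z (V * A) ∧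
          B (A * U) = B (V * A) := by
      intro x y z n hn h
      obtain ⟨A, hA⟩ := exists_hasCoords x y z n hn
      exact ⟨A, h A hA⟩
    simp only [HasCoords] at key
    rintro ⟨hB, ⟨hB3, h | h | h⟩ | ⟨hB3, h⟩⟩
    · refine key 0 0 0 0 (by omega) fun A hA => ?_
      have h1 := coords_mul A U
      have h2 := coords_mul V A
      omega
    · refine key 0 0 0 1 (by omega) fun A hA => ?_
      have h1 := coords_mul A U
      have h2 := coords_mul V A
      omega
    · refine key 0 0 0 2 (by omega) fun A hA => ?_
      have h1 := coords_mul A U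
      have h2 := coords_mul V A
      omega
    · obtain h3 | h3 : B U % 3 = 1 ∨ B U % 3 = 2 := by omega
      -- Three letters `b` cause no rotation and leave `z` free. The witness solves `x - y = X V - X
      -- U`, `y - z = Y V - Y U` in natural numbers; the third equation follows from equality of the
      -- sums.
      · refine key (X V + Y V) (X U + Y V) (X U + Y U) 3 (by omega) fun A hA => ?_
        have h1 := coords_mul A U
        have h2 := coords_mul V A
        omega
      -- The same with the opposite rotation: `x - z = X V - X U` and `y - x = Y V - Y U`.
      · refine key (X V + Y U) (X V + Y V) (X U + Y U) 3 (by omega) fun A hA => ?_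
        have h1 := coords_mul A U
        have h2 := coords_mul V A
        omega

/-! ### Computability: coordinates of a word by a primitive recursive fold -/

lemma act_ofWord (x : List (Fin 3)) (v : ℕ × ℕ × ℕ × ℕ) :
    act (ofWord x) v = x.foldr step v := by
  induction x with
  | nil => rw [ofWord_nil, act_one]; rfl
  | cons s x ih => rw [ofWord_cons, act_mul, ih, act_gen]; rfl

open Primrec in
lemma primrec_step : Primrec₂ step := by
  have h1 : Primrec fun v : ℕ × ℕ × ℕ × ℕ => v.1 := fst
  have h2 : Primrec fun v : ℕ × ℕ × ℕ × ℕ => v.2.1 := fst.comp snd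
  have h3 : Primrec fun v : ℕ × ℕ × ℕ × ℕ => v.2.2.1 := fst.comp (snd.comp snd)
  have h4 : Primrec fun v : ℕ × ℕ × ℕ × ℕ => v.2.2.2 := snd.comp (snd.comp snd)
  refine Primrec.ite (Primrec.eq.comp fst (const 0)) ?_
    (Primrec.ite (Primrec.eq.comp fst (const 1)) ?_ ?_)
  · exact (pair (succ.comp h1) (pair h2 (pair h3 h4))).comp snd
  · exact (pair h2 (pair h3 (pair h1 (succ.comp h4)))).comp snd
  · exact (pair h1 (pair (succ.comp h2) (pair h3 h4))).comp snd

open Primrec in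
lemma primrecRel_conjCoords : PrimrecRel ConjCoords := by
  have h1 : Primrec fun v : ℕ × ℕ × ℕ × ℕ => v.1 := fst
  have h2 : Primrec fun v : ℕ × ℕ × ℕ × ℕ => v.2.1 := fst.comp snd
  have h3 : Primrec fun v : ℕ × ℕ × ℕ × ℕ => v.2.2.1 := fst.comp (snd.comp snd)
  have h4 : Primrec fun v : ℕ × ℕ × ℕ × ℕ => v.2.2.2 := snd.comp (snd.comp snd)
  have hs := nat_add.comp (nat_add.comp h1 h2) h3
  have eq {f g : ℕ × ℕ × ℕ × ℕ → ℕ} (hf : Primrec f) (hg : Primrec g) :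
      PrimrecPred fun p : (ℕ × ℕ × ℕ × ℕ) × (ℕ × ℕ × ℕ × ℕ) => f p.1 = g p.2 :=
    Primrec.eq.comp (hf.comp fst) (hg.comp snd)
  have h0 : PrimrecPred fun p : (ℕ × ℕ × ℕ × ℕ) × (ℕ × ℕ × ℕ × ℕ) => p.1.2.2.2 % 3 = 0 :=
    Primrec.eq.comp (nat_mod.comp (h4.comp fst) (const 3)) (const 0)
  exact (eq h4 h4).and ((h0.and (((eq h1 h1).and ((eq h2 h2).and (eq h3 h3))).or
    (((eq h2 h1).and ((eq h3 h2).and (eq h1 h3))).or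
      ((eq h3 h1).and ((eq h1 h2).and (eq h2 h3)))))).or (h0.not.and (eq hs hs)))

open Primrec in
lemma conjugacyProblemSolvable : ConjugacyProblemSolvable := by
  have h : Primrec fun x : List (Fin 3) => x.foldr step (0, 0, 0, 0) :=
    list_foldr .id (const _) (primrec_step.comp₂ (fst.comp₂ .right) (snd.comp₂ .right))
  have h2 : PrimrecPred fun x : List (Fin 3) × List (Fin 3) =>
      ∃ A : G, A * ofWord x.1 = ofWord x.2 * A := by
    simp only [exists_mul_eq_mul_iff, act_ofWord]
    exact primrecRel_conjCoords.comp (h.comp fst) (h.comp snd)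
  exact h2.computablePred

end Bii

theorem mainTheorem2 :
    -- the LCM conditions fail
    (¬ Bii.LeftLCMCondition ∧ ¬ Bii.RightLCMCondition) ∧
    -- the elements `Δ i`
    (Bii.IsIndecomposableQuasiCentral (Bii.Δ 0) ∧ ¬ Bii.IsFundamental (Bii.Δ 0) ∧
      ∀ i : ℕ, 1 ≤ i → Bii.IsMinimalFundamental (Bii.Δ i)) ∧
    -- the normal forms with at most three letters `b`
    ((∀ w : Bii.G, w ∈ Bii.W 0 ↔ ∃ p q : ℕ, w = Bii.a ^ p * Bii.c ^ q) ∧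
      (∀ w : Bii.G, w ∈ Bii.W 1 ↔
        ∃ p q r : ℕ, w = Bii.a ^ p * Bii.c ^ q * Bii.b * Bii.a ^ r) ∧
      (∀ w : Bii.G, w ∈ Bii.W 2 ↔
        ∃ p q r : ℕ, w = Bii.a ^ p * Bii.c ^ q * Bii.b * Bii.b * Bii.c ^ r) ∧
      (∀ w : Bii.G, w ∈ Bii.W 3 ↔
        ∃ p q r : ℕ, w = Bii.a ^ p * Bii.c ^ q * Bii.b * Bii.a ^ r * Bii.b * Bii.b)) ∧
    -- Case 1: no letter `b`
    (Bii.TransMin 1 = {Bii.a, Bii.b, Bii.c} ∧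
      (∀ q : ℕ, 1 ≤ q →
        Bii.TransMin (Bii.c ^ q) = {Bii.a, Bii.c, Bii.b * Bii.b}) ∧
      (∀ p : ℕ, 1 ≤ p →
        Bii.TransMin (Bii.a ^ p) = {Bii.a, Bii.b, Bii.c}) ∧
      (∀ p q : ℕ, 1 ≤ p → 1 ≤ q →
        Bii.TransMin (Bii.a ^ p * Bii.c ^ q) =
          {Bii.a, Bii.c} ∪ {u | ∃ i : ℕ, u = Bii.b * Bii.b * Bii.c ^ i * Bii.b})) ∧
    -- Case 2: one letter `b`
    ((∀ q r : ℕ, 1 ≤ q →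
        Bii.TransMin (Bii.c ^ q * Bii.b * Bii.a ^ r) = {Bii.b, Bii.c}) ∧
      (∀ p r : ℕ, 1 ≤ p →
        Bii.TransMin (Bii.a ^ p * Bii.b * Bii.a ^ r) =
          {Bii.a} ∪ {u | ∃ i : ℕ, i ≤ r ∧ u = Bii.c ^ i * Bii.b * Bii.a ^ i}) ∧
      (∀ p q r : ℕ, 1 ≤ p → 1 ≤ q →
        Bii.TransMin (Bii.a ^ p * Bii.c ^ q * Bii.b * Bii.a ^ r) =
          {Bii.a, Bii.b, Bii.c}) ∧
      (∀ r : ℕ,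
        Bii.TransMin (Bii.b * Bii.a ^ r) =
          {u | ∃ i : ℕ, i ≤ r ∧ u = Bii.c ^ i * Bii.b * Bii.a ^ i} ∪
          {u | ∃ i : ℕ, r + 1 ≤ i ∧
            u = Bii.a ^ (i - r) * Bii.c ^ i * Bii.b * Bii.a ^ i})) ∧
    -- Case 3: two letters `b`
    ((∀ q r : ℕ, 1 ≤ q →
        Bii.TransMin (Bii.c ^ q * Bii.b * Bii.b * Bii.c ^ r) = {Bii.b, Bii.c}) ∧
      (∀ p r : ℕ, 1 ≤ p →
        Bii.TransMin (Bii.a ^ p * Bii.b * Bii.b * Bii.c ^ r) = {Bii.a, Bii.b}) ∧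
      (∀ p q r : ℕ, 1 ≤ p → 1 ≤ q →
        Bii.TransMin (Bii.a ^ p * Bii.c ^ q * Bii.b * Bii.b * Bii.c ^ r) =
          {Bii.a, Bii.b, Bii.c}) ∧
      (∀ r : ℕ,
        Bii.TransMin (Bii.b * Bii.b * Bii.c ^ r) =
          {u | ∃ i : ℕ, u = Bii.a ^ i * Bii.c ^ i * Bii.b * Bii.a ^ i})) ∧
    -- Case 4: three letters `b`
    (∀ w ∈ Bii.W 3, Bii.TransMin w = {Bii.a, Bii.b, Bii.c}) ∧
    -- every right minimal transit element of every element left-divides some `Δ i`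
    (∀ w : Bii.G, ∀ u ∈ Bii.TransMin w, ∃ i : ℕ, Bii.LeftDvd u (Bii.Δ i)) ∧
    -- the conjugacy problem is solvable
    Bii.ConjugacyProblemSolvable := by
  refine ⟨⟨Bii.not_leftLCMCondition, Bii.not_rightLCMCondition⟩,
    ⟨Bii.isIndecomposableQuasiCentral_Δ_zero, Bii.not_isFundamental_Δ_zero,
      fun i hi => Bii.isMinimalFundamental_Δ hi⟩,
    ⟨Bii.mem_W_zero_iff, Bii.mem_W_one_iff, Bii.mem_W_two_iff, Bii.mem_W_three_iff⟩,
    ⟨Bii.transMin_one, fun q hq => Bii.transMin_c_pow hq, fun p hp => Bii.transMin_a_pow hp,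
      fun p q hp hq => Bii.transMin_a_pow_mul_c_pow hp hq⟩,
    ⟨fun q r hq => ?_, fun p r hp => ?_, fun p q r hp hq => ?_, fun r => ?_⟩,
    ⟨fun q r hq => ?_, fun p r hp => ?_, fun p q r hp hq => ?_, fun r => ?_⟩, fun w hw => ?_,
    fun w u hu => Bii.exists_leftDvd_Δ_of_mem_transMin hu, Bii.conjugacyProblemSolvable⟩
  · have h := Bii.hasCoords_W_one 0 q r
    rw [pow_zero, one_mul] at h
    exact h.transMin_one_zero_pos hq
  · have h := Bii.hasCoords_W_one p 0 r
    rw [pow_zero, mul_one] at h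
    exact h.transMin_one_pos_zero hp
  · exact (Bii.hasCoords_W_one p q r).transMin_one_pos_pos hp hq
  · have h := Bii.hasCoords_W_one 0 0 r
    rw [pow_zero, pow_zero, one_mul, one_mul] at h
    exact h.transMin_one_zero_zero
  · have h := Bii.hasCoords_W_two 0 q r
    rw [pow_zero, one_mul] at h
    exact h.transMin_two_zero_pos hq
  · have h := Bii.hasCoords_W_two p 0 r
    rw [pow_zero, mul_one] at h
    exact h.transMin_two_pos_zero hp
  · exact (Bii.hasCoords_W_two p q r).transMin_two_pos_pos hp hq
  · have h := Bii.hasCoords_W_two 0 0 r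
    rw [pow_zero, pow_zero, one_mul, one_mul] at h
    exact h.transMin_two_zero_zero
  · have h : Bii.HasCoords w (Bii.X w) (Bii.Y w) (Bii.Z w) 3 :=
      ⟨rfl, rfl, rfl, (Bii.mem_W_iff 3 w).1 hw⟩
    exact h.transMin_three
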